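/- Let $\lambda,\mu,\nu\ge 0$. For each integer $N\ge 1$ let $\Xi^N(t)=(\Xi^N_1(t),\Xi^N_2(t),\Xi^N_3(t))$, $t\ge 0$, be a time-homogeneous Markov process with values in $\{M\in\mathbb Z_+^3: M_1\le N\}$ ($N$ two-level atoms, of which $M_1$ are excited; $M_2$ and $M_3$ count the photons emitted spontaneously and by stimulated emission) whose infinitesimal generator is $$\begin{aligned}\mathbf L G(M_1,M_2,M_3)={}&\lambda(N-M_1)\,[G(M_1+1,M_2,M_3)-G(M_1,M_2,M_3)]\\&+\mu M_1\,[G(M_1-1,M_2+1,M_3)-G(M_1,M_2,M_3)]\\&+\nu M_1\,[G(M_1-1,M_2,M_3+2)-G(M_1,M_2,M_3)].\end{aligned}$$ Put $\xi^N(t)=\frac1N\Xi^N(t)$. Suppose that, as $N\to\infty$, $\xi^N(0)$ converges in probability to a point $u^0=(u_1^0,u_2^0,u_3^0)\in\mathbb R_+^3$. Then for every $t>0$ the random vector $\xi^N(t)$ converges in probability, as $N\to\infty$, to the non-random vector $(x_1(t),x_2(t),x_3(t))$, where $(x_1,x_2,x_3)$ is the unique solution on $[0,\infty)$ of the linear system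 $$\dot x_1=\lambda(1-x_1)-(\mu+\nu)x_1,\qquad \dot x_2=\mu x_1,\qquad \dot x_3=2\nu x_1$$ with $x_i(0)=u_i^0$ for $i=1,2,3$. -/

import Mathlib

open MeasureTheory ProbabilityTheory Filter Topology
open scoped NNReal ENNReal

namespace TwoLevelAtoms

/-- The states `(M₁, M₂, M₃) ∈ ℤ₊³` with `M₁ ≤ N`: `M₁` is the number of excited atoms among the
`N` atoms, `M₂` the number of spontaneously emitted photons, `M₃` the number of photons emitted by
stimulated emission. The σ-algebra is the discrete one. -/
abbrev State (N : ℕ) : Type := {M : ℕ × ℕ × ℕ // M.1 ≤ N}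

/-- The infinitesimal operator `𝐋` of the unscaled process, for a function `G` on `ℤ₊³`. On the
states `M₁ ≤ N` it only involves values of `G` at such states: the rate `λ (N - M₁)` is zero for
`M₁ = N`, and the rates `μ M₁`, `ν M₁` are zero for `M₁ = 0` (where `M₁ - 1` truncates). -/
noncomputable def generator (lam mu nu : ℝ) (N : ℕ) (G : ℕ × ℕ × ℕ → ℝ) : ℕ × ℕ × ℕ → ℝ :=
  fun (M₁, M₂, M₃) =>
    lam * ((N : ℝ) - (M₁ : ℝ)) * (G (M₁ + 1, M₂, M₃) - G (M₁, M₂, M₃))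
      + mu * (M₁ : ℝ) * (G (M₁ - 1, M₂ + 1, M₃) - G (M₁, M₂, M₃))
      + nu * (M₁ : ℝ) * (G (M₁ - 1, M₂, M₃ + 2) - G (M₁, M₂, M₃))

/-- `p` is a time-homogeneous semigroup of Markov transition kernels. -/
structure IsTransitionSemigroup {S : Type*} [MeasurableSpace S] (p : ℝ≥0 → Kernel S S) : Prop where
  markov : ∀ t, IsMarkovKernel (p t)
  zero : p 0 = Kernel.id
  add : ∀ s t, p (s + t) = p t ∘ₖ p s

/-- The infinitesimal generator of the semigroup `p`, on the bounded functions with the supremum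
norm, is `𝐋`: `(p_t G - G) / t → 𝐋 G` uniformly as `t ↓ 0`, for every bounded `G`.
(`𝐋` is a bounded operator, so its domain is the whole space.) -/
def HasGenerator (lam mu nu : ℝ) (N : ℕ) (p : ℝ≥0 → Kernel (State N) (State N)) : Prop :=
  ∀ G : ℕ × ℕ × ℕ → ℝ, (∃ C : ℝ, ∀ M, |G M| ≤ C) →
    TendstoUniformly
      (fun (t : ℝ≥0) (M : State N) => ((∫ M' : State N, G M'.1 ∂(p t M)) - G M.1) / (t : ℝ))
      (fun M : State N => generator lam mu nu N G M.1)
      (𝓝[>] 0)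

/-- `X` is a Markov process, with respect to its own history and with transition semigroup `p`. -/
structure IsMarkovProcess {Ω S : Type*} [MeasurableSpace Ω] [MeasurableSpace S]
    (P : Measure Ω) (p : ℝ≥0 → Kernel S S) (X : ℝ≥0 → Ω → S) : Prop where
  measurable : ∀ t, Measurable (X t)
  condExp_eq : ∀ (s t : ℝ≥0) (f : S → ℝ), Measurable f → (∃ C : ℝ, ∀ y, |f y| ≤ C) →
    P[fun ω => f (X (s + t) ω) | ⨆ r ∈ Set.Iic s, MeasurableSpace.comap (X r) inferInstance]
      =ᵐ[P] fun ω => ∫ y, f y ∂(p t (X s ω))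

/-- `Ξ` is a version of the process `Ξ = (Ξ₁, Ξ₂, Ξ₃)` for `N` atoms: a Markov process whose
dynamics is driven by the infinitesimal operator `𝐋`. The initial law is arbitrary, and nothing is
required of the paths, so every version (in particular the one with jump-wise paths) is covered. -/
def IsPhotonProcess {Ω : Type*} [MeasurableSpace Ω] (lam mu nu : ℝ) (N : ℕ) (P : Measure Ω)
    (Xi : ℝ≥0 → Ω → State N) : Prop :=
  ∃ p : ℝ≥0 → Kernel (State N) (State N),
    IsTransitionSemigroup p ∧ HasGenerator lam mu nu N p ∧ IsMarkovProcess P p Xi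

/-- The scaled state `M / N ∈ ℝ³`. -/
noncomputable def scaled {N : ℕ} (M : State N) : EuclideanSpace ℝ (Fin 3) :=
  !₂[(M.1.1 : ℝ) / N, (M.1.2.1 : ℝ) / N, (M.1.2.2 : ℝ) / N]

/-- Convergence in probability to a constant, for random variables `Y N` that may live on different
probability spaces. -/
def TendstoInProbability {Ω : ℕ → Type*} [∀ N, MeasurableSpace (Ω N)] {E : Type*} [Dist E]
    (P : ∀ N, Measure (Ω N)) (Y : ∀ N, Ω N → E) (c : E) : Prop :=
  ∀ ε : ℝ, 0 < ε → Tendsto (fun N => P N {ω | ε ≤ dist (Y N ω) c}) atTop (𝓝 0)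

/-- `x` solves on `[0, ∞)`, with `x 0 = u`, the system `ẋ₁ = λ(1 - x₁) - (μ + ν)x₁`, `ẋ₂ = μ x₁`,
`ẋ₃ = 2 ν x₁` (two photons per stimulated emission). Coordinates are numbered `0, 1, 2`. -/
structure IsFluidSolution (lam mu nu : ℝ) (u : EuclideanSpace ℝ (Fin 3))
    (x : ℝ → EuclideanSpace ℝ (Fin 3)) : Prop where
  init : x 0 = u
  deriv₁ : ∀ t : ℝ, 0 ≤ t → HasDerivWithinAt (fun s => x s 0)
    (lam * (1 - x t 0) - (mu + nu) * x t 0) (Set.Ici 0) t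
  deriv₂ : ∀ t : ℝ, 0 ≤ t → HasDerivWithinAt (fun s => x s 1) (mu * x t 0) (Set.Ici 0) t
  deriv₃ : ∀ t : ℝ, 0 ≤ t → HasDerivWithinAt (fun s => x s 2) (2 * nu * x t 0) (Set.Ici 0) t

end TwoLevelAtoms

namespace TwoLevelAtoms

/-! The proof is a Lyapunov argument: bound the mean distance to the fluid solution by Grönwall,
then apply Markov's inequality. The generator is given only on bounded functions, and the photon
counts are unbounded, so the squared distance is replaced by `deviation`: the square in the first
coordinate (the scaled state there lies in [0,1]) and the bounded function `bump r = r²/(1+r²)` in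
the other two.

Jumps of size O(1/N) at rates O(N) make 𝐋 act on `deviation` as the fluid drift plus O(1/N)
(`stateGenerator_deviation_le`). The drift is one-sided Lipschitz because `bumpDeriv² ≤ 4 bump`. For
f(s) the mean deviation of the process from x(s) at time s, this yields f(s+h) ≤ (1+Ch) f(s) +
O(h/N) + K h².

Paths are never used. The step inequality comes from the Markov property and a second-order
expansion of the semigroup (`abs_integral_sub_sub_le`), available because 𝐋 is bounded for fixed N.
K depends on N, but h → 0 at fixed N removes it (`le_exp_mul_of_step`). Hence f(t) ≤ e^{Ct}(f(0) +
O(1/N)), which tends to 0. -/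

/-! ### Short-time expansion of a Markov semigroup from its generator. -/

/-- The uniform limit as t ↓ 0 is sampled along t/n, so that a fixed time splits into n equal steps
on which the first-order expansion is uniformly accurate. -/
theorem exists_uniform_step {S : Type*} {F : ℝ≥0 → S → ℝ} {G H : S → ℝ}
    (h : TendstoUniformly (fun (t : ℝ≥0) y => (F t y - G y) / (t : ℝ)) H (𝓝[>] 0))
    {t : ℝ≥0} (ht : 0 < t) {ε : ℝ} (hε : 0 < ε) :
    ∃ n : ℕ, 0 < n ∧ ∀ y, |F (t / n) y - G y - (t / n : ℝ) * H y| ≤ (t / n : ℝ) * ε := by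
  have hlim : Tendsto (fun n : ℕ => t / (n : ℝ≥0)) atTop (𝓝[>] 0) := by
    refine tendsto_nhdsWithin_iff.2 ⟨?_, ?_⟩
    · refine NNReal.tendsto_coe.1 ?_
      simpa using tendsto_const_div_atTop_nhds_zero_nat (t : ℝ)
    filter_upwards [eventually_gt_atTop 0] with n hn
    have : (0 : ℝ≥0) < n := by exact_mod_cast hn
    exact div_pos ht this
  obtain ⟨n, hn, hn0⟩ := ((hlim.eventually (Metric.tendstoUniformly_iff.1 h ε hε)).and
    (eventually_gt_atTop 0)).exists
  refine ⟨n, hn0, fun y => ?_⟩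
  have hpos : (0 : ℝ) < t / n := by
    have : (0 : ℝ) < n := by exact_mod_cast hn0
    have : (0 : ℝ) < t := ht
    positivity
  have h1 := hn y
  rw [Real.dist_eq, abs_sub_comm, NNReal.coe_div, NNReal.coe_natCast] at h1
  have h2 : F (t / n) y - G y - (t / n : ℝ) * H y
      = (t / n : ℝ) * ((F (t / n) y - G y) / (t / n : ℝ) - H y) := by
    field_simp
  rw [h2, abs_mul, abs_of_pos hpos]
  exact mul_le_mul_of_nonneg_left h1.le hpos.le

theorem abs_integral_le_of_abs_le {S : Type*} [MeasurableSpace S]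
    {m : Measure S} [IsProbabilityMeasure m] {G : S → ℝ} {B : ℝ}
    (hG : ∀ y, |G y| ≤ B) : |∫ y, G y ∂m| ≤ B := by
  have := norm_integral_le_of_norm_le_const (μ := m) (f := G) (C := B)
    (Eventually.of_forall fun y => by simpa using hG y)
  simpa using this

section Semigroup

variable {S : Type*} [MeasurableSpace S] [DiscreteMeasurableSpace S]

theorem integrable_of_abs_le {m : Measure S} [IsFiniteMeasure m] {G : S → ℝ} {B : ℝ}
    (hG : ∀ y, |G y| ≤ B) : Integrable G m :=
  Integrable.of_bound Measurable.of_discrete.aestronglyMeasurable B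
    (Eventually.of_forall fun y => by simpa using hG y)

theorem IsTransitionSemigroup.integral_add {p : ℝ≥0 → Kernel S S} (hp : IsTransitionSemigroup p)
    {G : S → ℝ} {B : ℝ} (hG : ∀ y, |G y| ≤ B) (s t : ℝ≥0) (y : S) :
    ∫ z, G z ∂(p (s + t) y) = ∫ w, ∫ z, G z ∂(p t w) ∂(p s y) := by
  have := hp.markov
  rw [hp.add s t, Kernel.integral_comp]
  exact integrable_of_abs_le hG

theorem IsTransitionSemigroup.integral_zero {p : ℝ≥0 → Kernel S S} (hp : IsTransitionSemigroup p)
    (G : S → ℝ) (y : S) : ∫ z, G z ∂(p 0 y) = G y := by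
  rw [hp.zero, Kernel.id_apply, integral_dirac]

/-- A semigroup is within `K B t` of the identity if its generator has norm `K`. -/
theorem IsTransitionSemigroup.abs_integral_sub_le {p : ℝ≥0 → Kernel S S}
    (hp : IsTransitionSemigroup p) {G H : S → ℝ} {B C : ℝ} (hG : ∀ y, |G y| ≤ B)
    (hH : ∀ y, |H y| ≤ C)
    (hgen : TendstoUniformly (fun (t : ℝ≥0) y => ((∫ z, G z ∂(p t y)) - G y) / (t : ℝ)) H
      (𝓝[>] 0)) (t : ℝ≥0) (y : S) :
    |(∫ z, G z ∂(p t y)) - G y| ≤ t * C := by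
  have := hp.markov
  refine le_of_forall_pos_le_add fun ε hε => ?_
  rcases eq_or_ne t 0 with rfl | ht
  · simp [hp.integral_zero, hε.le]
  have htpos : 0 < t := pos_iff_ne_zero.2 ht
  have htpos' : (0 : ℝ) < t := htpos
  obtain ⟨n, hn, hstep⟩ := exists_uniform_step hgen htpos (ε := ε / t) (by positivity)
  -- Telescoping: averaging the one-step bound against the probability `p (k * (t / n)) y` preserves
  -- it, so the bounds add. With accuracy ε/t the total error over n steps is ε.
  have key : ∀ k : ℕ, ∀ y, |(∫ z, G z ∂(p (k * (t / n)) y)) - G y|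
      ≤ k * ((t / n : ℝ) * (C + ε / t)) := by
    intro k
    induction k with
    | zero => intro y; simp [hp.integral_zero]
    | succ k ih =>
      intro y
      have hone : ∀ w, |(∫ z, G z ∂(p (t / n) w)) - G w| ≤ (t / n : ℝ) * (C + ε / t) := by
        intro w
        have h1 := hstep w
        have h2 : |(t / n : ℝ) * H w| ≤ (t / n : ℝ) * C := by
          rw [abs_mul, abs_of_nonneg (by positivity)]
          exact mul_le_mul_of_nonneg_left (hH w) (by positivity)
        have h3 := abs_add_le ((∫ z, G z ∂(p (t / n) w)) - G w - (t / n : ℝ) * H w)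
          ((t / n : ℝ) * H w)
        rw [sub_add_cancel] at h3
        linarith
      have hadd : ((k + 1 : ℕ) : ℝ≥0) * (t / n) = k * (t / n) + t / n := by push_cast; ring
      rw [hadd, hp.integral_add hG]
      have hI : Integrable (fun w => ∫ z, G z ∂(p (t / n) w)) (p (k * (t / n)) y) :=
        integrable_of_abs_le fun w => abs_integral_le_of_abs_le hG
      have h4 : |(∫ w, ((∫ z, G z ∂(p (t / n) w)) - G w) ∂(p (k * (t / n)) y))|
          ≤ (t / n : ℝ) * (C + ε / t) := abs_integral_le_of_abs_le hone
      rw [integral_sub hI (integrable_of_abs_le hG)] at h4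
      have h5 := abs_add_le ((∫ w, (∫ z, G z ∂(p (t / n) w)) ∂(p (k * (t / n)) y))
        - (∫ w, G w ∂(p (k * (t / n)) y))) ((∫ w, G w ∂(p (k * (t / n)) y)) - G y)
      rw [sub_add_sub_cancel] at h5
      have := ih y
      push_cast
      linarith
  have hfin := key n y
  have hn' : (n : ℝ≥0) ≠ 0 := by exact_mod_cast hn.ne'
  have hn'' : (n : ℝ) ≠ 0 := by exact_mod_cast hn.ne'
  rw [mul_div_cancel₀ t hn'] at hfin
  calc _ ≤ _ := hfin
    _ = t * C + ε := by field_simp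

/-- Second order expansion of the semigroup. -/
theorem IsTransitionSemigroup.abs_integral_sub_sub_le {p : ℝ≥0 → Kernel S S}
    (hp : IsTransitionSemigroup p) {G H H₂ : S → ℝ} {B C D : ℝ} (hG : ∀ y, |G y| ≤ B)
    (hH : ∀ y, |H y| ≤ C) (hH₂ : ∀ y, |H₂ y| ≤ D)
    (hgen : TendstoUniformly (fun (t : ℝ≥0) y => ((∫ z, G z ∂(p t y)) - G y) / (t : ℝ)) H
      (𝓝[>] 0))
    (hgen₂ : TendstoUniformly (fun (t : ℝ≥0) y => ((∫ z, H z ∂(p t y)) - H y) / (t : ℝ)) H₂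
      (𝓝[>] 0)) (t : ℝ≥0) (y : S) :
    |(∫ z, G z ∂(p t y)) - G y - t * H y| ≤ D * t ^ 2 := by
  have := hp.markov
  have hD : 0 ≤ D := (abs_nonneg _).trans (hH₂ y)
  refine le_of_forall_pos_le_add fun ε hε => ?_
  rcases eq_or_ne t 0 with rfl | ht
  · simp [hp.integral_zero, hε.le]
  have htpos : 0 < t := pos_iff_ne_zero.2 ht
  have htpos' : (0 : ℝ) < t := htpos
  obtain ⟨n, hn, hstep⟩ := exists_uniform_step hgen htpos (ε := ε / t) (by positivity)
  have hn' : (n : ℝ≥0) ≠ 0 := by exact_mod_cast hn.ne'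
  have hn'' : (n : ℝ) ≠ 0 := by exact_mod_cast hn.ne'
  -- Step k contributes the average of `H` at time kt/n rather than `H y`; by the first-order bound
  -- applied to `H`, the replacement costs at most t·D per unit time.
  have key : ∀ k : ℕ, k ≤ n → ∀ y,
      |(∫ z, G z ∂(p (k * (t / n)) y)) - G y - k * (t / n : ℝ) * H y|
      ≤ k * ((t / n : ℝ) * (t * D + ε / t)) := by
    intro k
    induction k with
    | zero => intro _ y; simp [hp.integral_zero]
    | succ k ih =>
      intro hk y
      have hadd : ((k + 1 : ℕ) : ℝ≥0) * (t / n) = k * (t / n) + t / n := by push_cast; ring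
      rw [hadd, hp.integral_add hG]
      have hI : Integrable (fun w => ∫ z, G z ∂(p (t / n) w)) (p (k * (t / n)) y) :=
        integrable_of_abs_le fun w => abs_integral_le_of_abs_le hG
      have hIH : Integrable H (p (k * (t / n)) y) := integrable_of_abs_le hH
      have h4 := abs_integral_le_of_abs_le (m := p (k * (t / n)) y) hstep
      have hIG : Integrable (fun w => (∫ z, G z ∂(p (t / n) w)) - G w) (p (k * (t / n)) y) :=
        hI.sub (integrable_of_abs_le hG)
      rw [integral_sub hIG (hIH.const_mul _), integral_sub hI (integrable_of_abs_le hG), integral_const_mul] at h4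
      have h5 := hp.abs_integral_sub_le hH hH₂ hgen₂ (k * (t / n)) y
      have h6 : ((k * (t / n) : ℝ≥0) : ℝ) * D ≤ t * D := by
        refine mul_le_mul_of_nonneg_right ?_ hD
        have : (k : ℝ≥0) * (t / n) ≤ n * (t / n) := by
          gcongr; exact_mod_cast (Nat.le_succ k).trans hk
        rw [mul_div_cancel₀ t hn'] at this
        exact_mod_cast this
      have h7 : |(t / n : ℝ) * ((∫ z, H z ∂(p (k * (t / n)) y)) - H y)| ≤ (t / n : ℝ) * (t * D) := by
        rw [abs_mul, abs_of_nonneg (by positivity : (0 : ℝ) ≤ t / n)]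
        exact mul_le_mul_of_nonneg_left (h5.trans h6) (by positivity)
      have h8 := ih ((Nat.le_succ k).trans hk) y
      rw [abs_le] at h4 h7 h8 ⊢
      push_cast
      constructor <;> nlinarith [h4.1, h4.2, h7.1, h7.2, h8.1, h8.2]
  have hfin := key n le_rfl y
  rw [mul_div_cancel₀ t hn', mul_div_cancel₀ (t : ℝ) hn''] at hfin
  calc _ ≤ _ := hfin
    _ = D * t ^ 2 + ε := by field_simp

end Semigroup

/-! ### A bounded substitute for the square. -/

/-- A bounded function comparable with `r ^ 2` near `0`. -/
noncomputable def bump (r : ℝ) : ℝ := r ^ 2 / (1 + r ^ 2)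

/-- The derivative of `bump`. -/
noncomputable def bumpDeriv (r : ℝ) : ℝ := 2 * r / (1 + r ^ 2) ^ 2

theorem bump_nonneg (r : ℝ) : 0 ≤ bump r := by unfold bump; positivity

theorem bump_le_one (r : ℝ) : bump r ≤ 1 := by
  unfold bump; rw [div_le_one (by positivity)]; linarith

theorem bump_le_sq (r : ℝ) : bump r ≤ r ^ 2 :=
  div_le_self (sq_nonneg r) (by nlinarith [sq_nonneg r])

/-- This closes the Grönwall loop: by Young's inequality, cross terms with `bumpDeriv` are absorbed
into the deviation itself. -/
theorem bumpDeriv_sq_le (r : ℝ) : bumpDeriv r ^ 2 ≤ 4 * bump r := by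
  unfold bump bumpDeriv
  rw [div_pow, ← mul_div_assoc, div_le_div_iff₀ (by positivity) (by positivity)]
  have h : (1 + r ^ 2) ≤ ((1 + r ^ 2) ^ 2) ^ 2 := by
    rw [← pow_mul]; exact le_self_pow₀ (by nlinarith [sq_nonneg r]) (by norm_num)
  nlinarith [mul_le_mul_of_nonneg_left h (sq_nonneg r)]

theorem abs_bumpDeriv_le (r : ℝ) : |bumpDeriv r| ≤ 2 := by
  refine abs_le_of_sq_le_sq ?_ (by norm_num)
  nlinarith [bumpDeriv_sq_le r, bump_le_one r]

theorem abs_bump_add_sub_le (r d : ℝ) :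
    |bump (r + d) - bump r - bumpDeriv r * d| ≤ 3 * d ^ 2 := by
  -- The Taylor remainder is exactly d² times a rational function; what remains is to bound that
  -- function by 3.
  have h : bump (r + d) - bump r - bumpDeriv r * d
      = d ^ 2 * (-((r ^ 2 + 2 * r * (r + d) - 1)) / ((1 + r ^ 2) ^ 2 * (1 + (r + d) ^ 2))) := by
    unfold bump bumpDeriv
    field_simp
    ring
  rw [h, abs_mul, abs_of_nonneg (sq_nonneg d), mul_comm]
  refine mul_le_mul_of_nonneg_right ?_ (sq_nonneg d)
  rw [abs_div, abs_neg, abs_of_pos (by positivity : 0 < (1 + r ^ 2) ^ 2 * (1 + (r + d) ^ 2)),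
    div_le_iff₀ (by positivity), abs_le]
  have h1 : 0 ≤ r ^ 2 := sq_nonneg r
  have h2 : 0 ≤ (r + d) ^ 2 := sq_nonneg _
  have h3 : 0 ≤ r ^ 2 * (r + d) ^ 2 := by positivity
  have h4 : 0 ≤ (r ^ 2) ^ 2 * (1 + (r + d) ^ 2) := by positivity
  constructor <;> nlinarith [sq_nonneg (r + (r + d)), sq_nonneg (r - (r + d))]

/-- With r the sum of squares, each summand on the right dominates its square divided by 1+r, and
r/(1+r) is increasing. A small deviation thus forces a small distance. -/
theorem sq_div_le_lyapunov {a b c ε : ℝ} (h : ε ^ 2 ≤ a ^ 2 + b ^ 2 + c ^ 2) :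
    ε ^ 2 / (1 + ε ^ 2) ≤ a ^ 2 + bump b + bump c := by
  set r := a ^ 2 + b ^ 2 + c ^ 2 with hr
  have hr0 : 0 ≤ r := by positivity
  have h1 : ε ^ 2 / (1 + ε ^ 2) ≤ r / (1 + r) := by
    rw [div_le_div_iff₀ (by positivity) (by positivity)]; nlinarith
  have hx : ∀ x : ℝ, 0 ≤ x ^ 2 → x ^ 2 ≤ r → x ^ 2 / (1 + r) ≤ bump x := fun x _ hxr =>
    div_le_div_of_nonneg_left (sq_nonneg x) (by positivity) (by linarith)
  have h2 := hx b (sq_nonneg b) (by nlinarith [sq_nonneg a, sq_nonneg c])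
  have h3 := hx c (sq_nonneg c) (by nlinarith [sq_nonneg a, sq_nonneg b])
  have h4 : a ^ 2 / (1 + r) ≤ a ^ 2 := div_le_self (sq_nonneg a) (by linarith)
  have h5 : r / (1 + r) = a ^ 2 / (1 + r) + b ^ 2 / (1 + r) + c ^ 2 / (1 + r) := by
    rw [hr]; ring
  linarith

/-! ### Discrete Grönwall inequality. -/

/-- A discrete Grönwall inequality with vanishing step. -/
theorem le_exp_mul_of_step {f : ℝ≥0 → ℝ} {T : ℝ≥0} {C a K : ℝ} (hC : 0 ≤ C) (ha : 0 ≤ a)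
    (hK : 0 ≤ K) (hf : 0 ≤ f 0)
    (hstep : ∀ s h : ℝ≥0, s + h ≤ T → f (s + h) ≤ (1 + C * h) * f s + h * a + K * h ^ 2) :
    f T ≤ Real.exp (C * T) * (f 0 + T * a) := by
  -- Over n steps of length T/n the quadratic errors sum to KT²/n, which vanishes as n → ∞; no
  -- regularity of `f` is needed.
  have hn : ∀ n : ℕ, 0 < n → f T ≤ Real.exp (C * T) * (f 0 + T * a + K * T ^ 2 / n) := by
    intro n hn
    have hn' : (n : ℝ≥0) ≠ 0 := by exact_mod_cast hn.ne'
    have hnpos : (0 : ℝ) < n := by exact_mod_cast hn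
    set h : ℝ≥0 := T / n with hh
    have hhc : (h : ℝ) = T / n := by simp [hh]
    have key : ∀ k : ℕ, k ≤ n →
        f (k * h) ≤ (1 + C * h) ^ k * (f 0 + k * (h * a + K * h ^ 2)) := by
      intro k
      induction k with
      | zero => simp
      | succ k ih =>
        intro hk
        have hadd : ((k + 1 : ℕ) : ℝ≥0) * h = k * h + h := by push_cast; ring
        have hle : (k : ℝ≥0) * h + h ≤ T := by
          rw [← hadd]
          calc ((k + 1 : ℕ) : ℝ≥0) * h ≤ n * h := by gcongr
            _ = T := mul_div_cancel₀ T hn'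
        have h1 := hstep (k * h) h hle
        have h2 : (1 + C * h) * f (k * h)
            ≤ (1 + C * h) * ((1 + C * h) ^ k * (f 0 + k * (h * a + K * h ^ 2))) :=
          mul_le_mul_of_nonneg_left (ih ((Nat.le_succ k).trans hk)) (by positivity)
        have h3 : (1 : ℝ) ≤ (1 + C * h) ^ (k + 1) :=
          one_le_pow₀ (by have : 0 ≤ C * h := by positivity
                          linarith)
        have h4 : 0 ≤ (h : ℝ) * a + K * h ^ 2 := by positivity
        rw [hadd]
        push_cast
        have h5 := mul_le_mul_of_nonneg_right h3 h4
        have h6 : (1 + C * h) ^ (k + 1) * (f 0 + (k + 1) * (h * a + K * h ^ 2))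
          = (1 + C * h) * ((1 + C * h) ^ k * (f 0 + k * (h * a + K * h ^ 2)))
            + (1 + C * h) ^ (k + 1) * (h * a + K * h ^ 2) := by ring
        linarith
    have h7 := key n le_rfl
    rw [mul_div_cancel₀ T hn'] at h7
    have h8 : (1 + C * (h : ℝ)) ^ n ≤ Real.exp (C * T) := by
      calc (1 + C * (h : ℝ)) ^ n ≤ Real.exp (C * h) ^ n := by
            gcongr; linarith [Real.add_one_le_exp (C * (h : ℝ))]
        _ = Real.exp (C * T) := by
            rw [← Real.exp_nat_mul, hhc]; congr 1; field_simp
    refine h7.trans (mul_le_mul h8 (le_of_eq ?_) (by positivity) (Real.exp_pos _).le)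
    rw [hhc]; field_simp; ring
  have hlim : Tendsto (fun n : ℕ => Real.exp (C * T) * (f 0 + T * a + K * T ^ 2 / n)) atTop
      (𝓝 (Real.exp (C * T) * (f 0 + T * a + 0))) :=
    ((tendsto_const_div_atTop_nhds_zero_nat (K * (T : ℝ) ^ 2)).const_add _).const_mul _
  rw [add_zero] at hlim
  exact ge_of_tendsto hlim ((eventually_gt_atTop 0).mono hn)

/-! ### Existence and uniqueness for the fluid equation. -/

/-- `∫₀ᵗ exp (-k s) ds`. -/
noncomputable def decay (k t : ℝ) : ℝ := ∫ s in (0 : ℝ)..t, Real.exp (-k * s)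

theorem decay_zero (k : ℝ) : decay k 0 = 0 := by simp [decay]

theorem hasDerivAt_decay (k t : ℝ) : HasDerivAt (decay k) (Real.exp (-k * t)) t := by
  have hc : Continuous fun s : ℝ => Real.exp (-k * s) := by fun_prop
  exact intervalIntegral.integral_hasDerivAt_right (hc.intervalIntegrable _ _)
    hc.stronglyMeasurable.stronglyMeasurableAtFilter hc.continuousAt

/-- Keeping `decay` as an integral avoids dividing by k, so k = 0 needs no separate case. -/
theorem mul_decay (k t : ℝ) : k * decay k t = 1 - Real.exp (-k * t) := by
  have h : ∀ s, HasDerivAt (fun s => k * decay k s + Real.exp (-k * s)) 0 s := by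
    intro s
    have h1 := ((hasDerivAt_decay k s).const_mul k).add
      (((hasDerivAt_id s).const_mul (-k)).exp)
    refine h1.congr_deriv ?_
    simp; ring
  have := is_const_of_deriv_eq_zero (fun s => (h s).differentiableAt) (fun s => (h s).deriv) t 0
  simp only [decay_zero, mul_zero, Real.exp_zero, zero_add] at this
  linarith

/-- The first coordinate of the fluid limit. -/
noncomputable def fluidFst (lam k u₀ t : ℝ) : ℝ := u₀ + (lam - k * u₀) * decay k t

/-- The fluid limit. -/
noncomputable def fluid (lam mu nu : ℝ) (u : EuclideanSpace ℝ (Fin 3)) (t : ℝ) :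
    EuclideanSpace ℝ (Fin 3) :=
  !₂[fluidFst lam (lam + mu + nu) (u 0) t,
    u 1 + mu * ∫ s in (0 : ℝ)..t, fluidFst lam (lam + mu + nu) (u 0) s,
    u 2 + 2 * nu * ∫ s in (0 : ℝ)..t, fluidFst lam (lam + mu + nu) (u 0) s]

theorem hasDerivAt_fluidFst (lam k u₀ t : ℝ) :
    HasDerivAt (fluidFst lam k u₀) (lam - k * fluidFst lam k u₀ t) t := by
  have h := ((hasDerivAt_decay k t).const_mul (lam - k * u₀)).const_add u₀
  refine h.congr_deriv ?_
  unfold fluidFst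
  linear_combination (lam - k * u₀) * mul_decay k t

theorem hasDerivAt_integral_fluidFst (lam k u₀ t : ℝ) :
    HasDerivAt (fun t => ∫ s in (0 : ℝ)..t, fluidFst lam k u₀ s) (fluidFst lam k u₀ t) t := by
  have hc : Continuous (fluidFst lam k u₀) :=
    continuous_iff_continuousAt.2 fun t => (hasDerivAt_fluidFst lam k u₀ t).continuousAt
  exact intervalIntegral.integral_hasDerivAt_right (hc.intervalIntegrable _ _)
    hc.stronglyMeasurable.stronglyMeasurableAtFilter hc.continuousAt

theorem isFluidSolution_fluid (lam mu nu : ℝ) (u : EuclideanSpace ℝ (Fin 3)) :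
    IsFluidSolution lam mu nu u (fluid lam mu nu u) where
  init := by
    ext i; fin_cases i <;> simp [fluid, fluidFst, decay_zero]
  deriv₁ t _ := by
    have h := hasDerivAt_fluidFst lam (lam + mu + nu) (u 0) t
    refine (h.congr_deriv ?_).hasDerivWithinAt
    simp [fluid]; ring
  deriv₂ t _ := ((hasDerivAt_integral_fluidFst lam (lam + mu + nu) (u 0) t).const_mul
    mu).const_add (u 1) |>.hasDerivWithinAt
  deriv₃ t _ := ((hasDerivAt_integral_fluidFst lam (lam + mu + nu) (u 0) t).const_mul
    (2 * nu)).const_add (u 2) |>.hasDerivWithinAt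

/-- Integrating factor: e^{kt} d(t) has zero derivative. -/
theorem eq_zero_of_linear_deriv {d : ℝ → ℝ} {k : ℝ} (h0 : d 0 = 0)
    (hd : ∀ t, 0 ≤ t → HasDerivWithinAt d (-k * d t) (Set.Ici 0) t) {t : ℝ} (ht : 0 ≤ t) :
    d t = 0 := by
  have he : ∀ s, 0 ≤ s →
      HasDerivWithinAt (fun s => Real.exp (k * s) * d s) 0 (Set.Ici 0) s := by
    intro s hs
    have h1 := (((hasDerivAt_id s).const_mul k).exp.hasDerivWithinAt (s := Set.Ici 0)).mul (hd s hs)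
    refine h1.congr_deriv ?_
    simp; ring
  have := constant_of_has_deriv_right_zero (a := 0) (b := t)
    (fun s hs => ((he s hs.1).continuousWithinAt).mono Set.Icc_subset_Ici_self)
    (fun s hs => (he s hs.1).mono (Set.Ici_subset_Ici.2 hs.1)) t ⟨ht, le_rfl⟩
  simpa [h0, (Real.exp_pos _).ne'] using this

/-- The system is triangular: the first difference decays linearly from 0, and once it vanishes the
other two have zero derivative (k = 0). -/
theorem IsFluidSolution.eqOn {lam mu nu : ℝ} {u : EuclideanSpace ℝ (Fin 3)}
    {x y : ℝ → EuclideanSpace ℝ (Fin 3)} (hy : IsFluidSolution lam mu nu u y)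
    (hx : IsFluidSolution lam mu nu u x) : Set.EqOn y x (Set.Ici 0) := by
  have h1 : ∀ t, 0 ≤ t → y t 0 - x t 0 = 0 := fun t ht =>
    eq_zero_of_linear_deriv (d := fun t => y t 0 - x t 0) (k := lam + mu + nu)
      (by simp [hx.init, hy.init])
      (fun t ht => ((hy.deriv₁ t ht).sub (hx.deriv₁ t ht)).congr_deriv (by ring)) ht
  have h2 : ∀ t, 0 ≤ t → y t 1 - x t 1 = 0 := fun t ht =>
    eq_zero_of_linear_deriv (d := fun t => y t 1 - x t 1) (k := 0)
      (by simp [hx.init, hy.init])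
      (fun t ht => ((hy.deriv₂ t ht).sub (hx.deriv₂ t ht)).congr_deriv (by
        linear_combination mu * h1 t ht)) ht
  have h3 : ∀ t, 0 ≤ t → y t 2 - x t 2 = 0 := fun t ht =>
    eq_zero_of_linear_deriv (d := fun t => y t 2 - x t 2) (k := 0)
      (by simp [hx.init, hy.init])
      (fun t ht => ((hy.deriv₃ t ht).sub (hx.deriv₃ t ht)).congr_deriv (by
        linear_combination 2 * nu * h1 t ht)) ht
  intro t ht
  ext i
  fin_cases i
  · exact sub_eq_zero.1 (h1 t ht)
  · exact sub_eq_zero.1 (h2 t ht)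
  · exact sub_eq_zero.1 (h3 t ht)

/-! ### Quantitative bounds along a fluid solution. -/

/-- Taylor's formula of order two at the right end of an interval, for a function whose
derivative is Lipschitz. -/
theorem abs_taylor_le_of_lipschitz_deriv {f f' : ℝ → ℝ} {T L : ℝ}
    (hf : ∀ t, 0 ≤ t → HasDerivWithinAt f (f' t) (Set.Ici 0) t)
    (hL : ∀ r s, 0 ≤ r → r ≤ s → s ≤ T → |f' r - f' s| ≤ L * (s - r)) {s h : ℝ} (hs : 0 ≤ s)
    (hh : 0 ≤ h) (hT : s + h ≤ T) :
    |f (s + h) - f s - h * f' (s + h)| ≤ L * h ^ 2 := by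
  have hL0 : 0 ≤ L * h := by
    have := hL s (s + h) hs (by linarith) hT
    have h0 := (abs_nonneg _).trans this
    simpa using h0
  -- Subtracting the line of slope `f' (s + h)` reduces the claim to the mean value inequality.
  have hd : ∀ r ∈ Set.Icc s (s + h), HasDerivWithinAt (fun r => f r - r * f' (s + h))
      (f' r - f' (s + h)) (Set.Icc s (s + h)) r := by
    intro r hr
    have h1 := (hf r (hs.trans hr.1)).mono
      (Set.Icc_subset_Ici_self.trans (Set.Ici_subset_Ici.2 hs) : Set.Icc s (s + h) ⊆ Set.Ici 0)
    refine (h1.sub ((hasDerivWithinAt_id r _).mul_const (f' (s + h)))).congr_deriv ?_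
    simp
  have hb : ∀ r ∈ Set.Icc s (s + h), ‖f' r - f' (s + h)‖ ≤ L * h := by
    intro r hr
    refine (hL r (s + h) (hs.trans hr.1) hr.2 hT).trans ?_
    -- The sign of `L` is not assumed; only `L * h ≥ 0` is known, so h = 0 is treated apart.
    rcases hh.eq_or_lt with rfl | hpos
    · have : r = s := le_antisymm (by simpa using hr.2) hr.1
      simp [this]
    · have : 0 ≤ L := by by_contra hneg; nlinarith
      exact mul_le_mul_of_nonneg_left (by linarith [hr.1]) this
  have := (convex_Icc s (s + h)).norm_image_sub_le_of_norm_hasDerivWithin_le hd hb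
    (Set.left_mem_Icc.2 (by linarith)) (Set.right_mem_Icc.2 (by linarith))
  rw [Real.norm_eq_abs, Real.norm_eq_abs, add_sub_cancel_left, abs_of_nonneg hh] at this
  calc _ = |f (s + h) - (s + h) * f' (s + h) - (f s - s * f' (s + h))| := by congr 1; ring
    _ ≤ _ := this
    _ = _ := by ring

/-- Uniform bounds on a fluid solution over `[0, T]`: its first coordinate, its increments, and its
first order expansion at the right end of an interval. -/
theorem IsFluidSolution.exists_bounds {lam mu nu : ℝ} (hlam : 0 ≤ lam) (hmu : 0 ≤ mu)
    (hnu : 0 ≤ nu) {u : EuclideanSpace ℝ (Fin 3)} {x : ℝ → EuclideanSpace ℝ (Fin 3)}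
    (hx : IsFluidSolution lam mu nu u x) (T : ℝ) :
    ∃ X D R : ℝ, 0 ≤ X ∧ 0 ≤ D ∧ 0 ≤ R ∧ ∀ s h : ℝ, 0 ≤ s → 0 ≤ h → s + h ≤ T →
      |x (s + h) 0| ≤ X ∧ (∀ i, |x (s + h) i - x s i| ≤ D * h) ∧
      |x (s + h) 0 - x s 0 - h * (lam * (1 - x (s + h) 0) - (mu + nu) * x (s + h) 0)|
        ≤ R * h ^ 2 ∧
      |x (s + h) 1 - x s 1 - h * (mu * x (s + h) 0)| ≤ R * h ^ 2 ∧
      |x (s + h) 2 - x s 2 - h * (2 * nu * x (s + h) 0)| ≤ R * h ^ 2 := by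
  have hcont : ContinuousOn (fun s => x s 0) (Set.Icc 0 T) := fun s hs =>
    (hx.deriv₁ s hs.1).continuousWithinAt.mono Set.Icc_subset_Ici_self
  obtain ⟨X₀, hX₀⟩ := isCompact_Icc.exists_bound_of_continuousOn hcont
  set X := max X₀ 0
  have hX0 : 0 ≤ X := le_max_right _ _
  have hX : ∀ s, 0 ≤ s → s ≤ T → |x s 0| ≤ X := fun s h1 h2 =>
    (hX₀ s ⟨h1, h2⟩).trans (le_max_left _ _)
  set D := lam + (lam + mu + nu) * X + mu * X + 2 * nu * X
  have hD0 : 0 ≤ D := by positivity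
  have hlx : 0 ≤ lam * X := by positivity
  have hmx : 0 ≤ mu * X := by positivity
  have hnx : 0 ≤ nu * X := by positivity
  have hlip : ∀ {f f' : ℝ → ℝ}, (∀ t, 0 ≤ t → HasDerivWithinAt f (f' t) (Set.Ici 0) t) →
      (∀ t, 0 ≤ t → t ≤ T → |f' t| ≤ D) → ∀ r s, 0 ≤ r → r ≤ s → s ≤ T →
      |f s - f r| ≤ D * (s - r) := by
    intro f f' hf hf' r s hr hrs hs
    have := (convex_Icc r s).norm_image_sub_le_of_norm_hasDerivWithin_le
      (fun t ht => (hf t (hr.trans ht.1)).mono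
        (Set.Icc_subset_Ici_self.trans (Set.Ici_subset_Ici.2 hr) : Set.Icc r s ⊆ Set.Ici 0))
      (fun t ht => hf' t (hr.trans ht.1) (ht.2.trans hs))
      (Set.left_mem_Icc.2 hrs) (Set.right_mem_Icc.2 hrs)
    rwa [Real.norm_eq_abs, Real.norm_eq_abs, abs_of_nonneg (sub_nonneg.2 hrs)] at this
  have h1 := hlip hx.deriv₁ (fun t h0 hT => by
    have := abs_le.1 (hX t h0 hT)
    rw [abs_le]; constructor <;> nlinarith)
  have h2 := hlip hx.deriv₂ (fun t h0 hT => by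
    have := abs_le.1 (hX t h0 hT)
    rw [abs_le]; constructor <;> nlinarith)
  have h3 := hlip hx.deriv₃ (fun t h0 hT => by
    have := abs_le.1 (hX t h0 hT)
    rw [abs_le]; constructor <;> nlinarith)
  -- All three right-hand sides are affine in the first coordinate, which is D-Lipschitz, so they
  -- are Lipschitz with one common constant.
  have hl : ∀ c : ℝ, |c| ≤ lam + mu + 2 * nu → ∀ r s, 0 ≤ r → r ≤ s → s ≤ T →
      |c * (x s 0 - x r 0)| ≤ (lam + mu + 2 * nu) * D * (s - r) := by
    intro c hc r s hr hrs hs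
    rw [abs_mul, mul_assoc]
    exact mul_le_mul hc (h1 r s hr hrs hs) (abs_nonneg _) (by positivity)
  refine ⟨X, D, (lam + mu + 2 * nu) * D, hX0, hD0, by positivity, fun s h hs hh hT => ?_⟩
  have hsh : s ≤ s + h := by linarith
  refine ⟨hX _ (by linarith) hT, ?_, ?_, ?_, ?_⟩
  · intro i
    have e : s + h - s = h := by ring
    fin_cases i
    · exact (h1 s (s + h) hs hsh hT).trans_eq (by rw [e])
    · exact (h2 s (s + h) hs hsh hT).trans_eq (by rw [e])
    · exact (h3 s (s + h) hs hsh hT).trans_eq (by rw [e])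
  · refine abs_taylor_le_of_lipschitz_deriv hx.deriv₁ (fun r s hr hrs hs => ?_) hs hh hT
    convert hl (lam + mu + nu) (by rw [abs_of_nonneg (by positivity)]; linarith) r s hr hrs hs
      using 2
    ring
  · refine abs_taylor_le_of_lipschitz_deriv hx.deriv₂ (fun r s hr hrs hs => ?_) hs hh hT
    convert hl (-mu) (by rw [abs_neg, abs_of_nonneg (by positivity)]; linarith) r s hr hrs hs
      using 2
    ring
  · refine abs_taylor_le_of_lipschitz_deriv hx.deriv₃ (fun r s hr hrs hs => ?_) hs hh hT
    convert hl (-(2 * nu)) (by rw [abs_neg, abs_of_nonneg (by positivity)]; linarith) r s hr hrs hs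
      using 2
    ring

/-! ### The generator as a bounded operator on functions of the state. -/

/-- Extension by zero of a function on the states to `ℤ₊³`. -/
noncomputable def extendZero {N : ℕ} (G : State N → ℝ) : ℕ × ℕ × ℕ → ℝ :=
  fun M => if h : M.1 ≤ N then G ⟨M, h⟩ else 0

theorem extendZero_apply {N : ℕ} (G : State N → ℝ) (M : State N) : extendZero G M.1 = G M :=
  dif_pos M.2

theorem extendZero_of_le {N : ℕ} (G : State N → ℝ) {M : ℕ × ℕ × ℕ} (h : M.1 ≤ N) :
    extendZero G M = G ⟨M, h⟩ := dif_pos h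

theorem abs_extendZero_le {N : ℕ} {G : State N → ℝ} {B : ℝ} (hG : ∀ M, |G M| ≤ B)
    (M : ℕ × ℕ × ℕ) : |extendZero G M| ≤ B := by
  unfold extendZero
  split_ifs with h
  · exact hG _
  · simpa using (abs_nonneg _).trans (hG ⟨(0, 0, 0), Nat.zero_le N⟩)

/-- The infinitesimal operator acting on functions on the states. -/
noncomputable def stateGenerator (lam mu nu : ℝ) {N : ℕ} (G : State N → ℝ) : State N → ℝ :=
  fun M => generator lam mu nu N (extendZero G) M.1

/-- Working on states allows 𝐋 to be iterated: on all of ℤ₊³ the rates are unbounded in M₁, and 𝐋G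
need not be bounded there. -/
theorem HasGenerator.tendstoUniformly {lam mu nu : ℝ} {N : ℕ}
    {p : ℝ≥0 → Kernel (State N) (State N)} (h : HasGenerator lam mu nu N p) {G : State N → ℝ}
    {B : ℝ} (hG : ∀ M, |G M| ≤ B) :
    TendstoUniformly (fun (t : ℝ≥0) M => ((∫ M', G M' ∂(p t M)) - G M) / (t : ℝ))
      (stateGenerator lam mu nu G) (𝓝[>] 0) := by
  have := h (extendZero G) ⟨B, abs_extendZero_le hG⟩
  simp only [extendZero_apply] at this
  exact this

theorem abs_stateGenerator_le {lam mu nu : ℝ} (hlam : 0 ≤ lam) (hmu : 0 ≤ mu) (hnu : 0 ≤ nu)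
    {N : ℕ} {G : State N → ℝ} {B : ℝ} (hG : ∀ M, |G M| ≤ B) (M : State N) :
    |stateGenerator lam mu nu G M| ≤ (lam + mu + nu) * N * (2 * B) := by
  obtain ⟨⟨a, b, c⟩, ha⟩ := M
  have ha' : (a : ℝ) ≤ N := by exact_mod_cast ha
  have ha0 : (0 : ℝ) ≤ a := Nat.cast_nonneg a
  have hE := abs_extendZero_le hG
  have hB : 0 ≤ B := (abs_nonneg _).trans (hE 0)
  have hd : ∀ r q : ℝ, ∀ M M', 0 ≤ r → 0 ≤ q → q ≤ N →
      |r * q * (extendZero G M - extendZero G M')| ≤ r * N * (2 * B) := by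
    intro r q M M' hr hq hqN
    rw [abs_mul, abs_of_nonneg (mul_nonneg hr hq)]
    refine mul_le_mul (mul_le_mul_of_nonneg_left hqN hr) ?_ (abs_nonneg _) (by positivity)
    linarith [abs_sub (extendZero G M) (extendZero G M'), hE M, hE M']
  have h1 := hd lam (N - a) (a + 1, b, c) (a, b, c) hlam (by linarith) (by linarith)
  have h2 := hd mu a (a - 1, b + 1, c) (a, b, c) hmu ha0 ha'
  have h3 := hd nu a (a - 1, b, c + 2) (a, b, c) hnu ha0 ha'
  calc |stateGenerator lam mu nu G ⟨(a, b, c), ha⟩|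
      ≤ _ := abs_add_three _ _ _
    _ ≤ _ := by linarith

/-- Expansion of the semigroup on bounded functions up to a quadratic error. -/
theorem abs_integral_sub_generator_le {lam mu nu : ℝ} (hlam : 0 ≤ lam) (hmu : 0 ≤ mu)
    (hnu : 0 ≤ nu) {N : ℕ} {p : ℝ≥0 → Kernel (State N) (State N)} (hp : IsTransitionSemigroup p)
    (h : HasGenerator lam mu nu N p) {G : State N → ℝ} {B : ℝ} (hG : ∀ M, |G M| ≤ B) (t : ℝ≥0)
    (M : State N) :
    |(∫ M', G M' ∂(p t M)) - G M - t * stateGenerator lam mu nu G M|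
      ≤ ((lam + mu + nu) * N * (2 * ((lam + mu + nu) * N * (2 * B)))) * t ^ 2 := by
  have h1 := abs_stateGenerator_le hlam hmu hnu hG
  exact hp.abs_integral_sub_sub_le hG h1 (abs_stateGenerator_le hlam hmu hnu h1)
    (h.tendstoUniformly hG) (h.tendstoUniformly h1) t M

/-! ### The Lyapunov function and its drift. -/

/-- A bounded measure of the deviation of the scaled state from the point `x`. -/
noncomputable def deviation {N : ℕ} (x : EuclideanSpace ℝ (Fin 3)) (M : State N) : ℝ :=
  (scaled M 0 - x 0) ^ 2 + bump (scaled M 1 - x 1) + bump (scaled M 2 - x 2)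

theorem deviation_nonneg {N : ℕ} (x : EuclideanSpace ℝ (Fin 3)) (M : State N) :
    0 ≤ deviation x M :=
  add_nonneg (add_nonneg (sq_nonneg _) (bump_nonneg _)) (bump_nonneg _)

theorem scaled_zero_mem {N : ℕ} (M : State N) : 0 ≤ scaled M 0 ∧ scaled M 0 ≤ 1 := by
  have h : scaled M 0 = (M.1.1 : ℝ) / N := rfl
  rw [h]
  exact ⟨by positivity, div_le_one_of_le₀ (Nat.cast_le.2 M.2) (by positivity)⟩

theorem deviation_le {N : ℕ} {x : EuclideanSpace ℝ (Fin 3)} {X : ℝ} (hx : |x 0| ≤ X)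
    (M : State N) : deviation x M ≤ (1 + X) ^ 2 + 2 := by
  have h := scaled_zero_mem M
  have h1 := abs_le.1 hx
  have : (scaled M 0 - x 0) ^ 2 ≤ (1 + X) ^ 2 :=
    sq_le_sq' (by linarith) (by linarith)
  unfold deviation
  linarith [bump_le_one (scaled M 1 - x 1), bump_le_one (scaled M 2 - x 2)]

theorem abs_deviation_le {N : ℕ} {x : EuclideanSpace ℝ (Fin 3)} {X : ℝ} (hx : |x 0| ≤ X)
    (M : State N) : |deviation x M| ≤ (1 + X) ^ 2 + 2 := by
  rw [abs_of_nonneg (deviation_nonneg x M)]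
  exact deviation_le hx M

/-- First-order Taylor terms give the drift; second-order terms are rate N times (jump/N)². The
square contributes 1 per jump and `bump` contributes 3·1² or 3·2², whence 1, 4 = 1+3 and 13 = 1+12.
-/
theorem stateGenerator_deviation_le {lam mu nu : ℝ} (hlam : 0 ≤ lam) (hmu : 0 ≤ mu) (hnu : 0 ≤ nu)
    {N : ℕ} (hN : 1 ≤ N) (x : EuclideanSpace ℝ (Fin 3)) (M : State N) :
    stateGenerator lam mu nu (deviation x) M ≤
      2 * (scaled M 0 - x 0) * (lam * (1 - scaled M 0) - (mu + nu) * scaled M 0)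
        + mu * scaled M 0 * bumpDeriv (scaled M 1 - x 1)
        + 2 * nu * scaled M 0 * bumpDeriv (scaled M 2 - x 2)
        + (lam + 4 * mu + 13 * nu) / N := by
  obtain ⟨⟨a, b, c⟩, ha⟩ := M
  have ha : a ≤ N := ha
  have hNpos : (0 : ℝ) < N := by exact_mod_cast hN
  have hN0 : (N : ℝ) ≠ 0 := hNpos.ne'
  have e0 : scaled (⟨(a, b, c), ha⟩ : State N) 0 = (a : ℝ) / N := rfl
  have e1 : scaled (⟨(a, b, c), ha⟩ : State N) 1 = (b : ℝ) / N := rfl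
  have e2 : scaled (⟨(a, b, c), ha⟩ : State N) 2 = (c : ℝ) / N := rfl
  have hdev : ∀ a' b' c' : ℕ, a' ≤ N → extendZero (deviation (N := N) x) (a', b', c')
      = ((a' : ℝ) / N - x 0) ^ 2 + bump ((b' : ℝ) / N - x 1) + bump ((c' : ℝ) / N - x 2) :=
    fun a' b' c' h => extendZero_of_le _ h
  rw [e0, e1, e2]
  set y := (a : ℝ) / N with hy
  have ha' : (a : ℝ) ≤ N := by exact_mod_cast ha
  have haN : (a : ℝ) = N * y := by rw [hy]; field_simp
  have hy0 : 0 ≤ y := by positivity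
  have hy1 : y ≤ 1 := div_le_one_of_le₀ ha' hNpos.le
  have hinv : 0 < 1 / (N : ℝ) := by positivity
  have t1 : lam * ((N : ℝ) - a) * (extendZero (deviation (N := N) x) (a + 1, b, c)
      - extendZero (deviation (N := N) x) (a, b, c))
      ≤ 2 * (y - x 0) * (lam * (1 - y)) + lam * (1 / N) := by
    -- At M₁ = N the upward jump leaves the state space, where `extendZero` is a default value, but
    -- its rate is zero.
    rcases ha.eq_or_lt with h | h
    · have : y = 1 := by rw [hy, h]; field_simp
      have h' : (N : ℝ) - a = 0 := by rw [h]; ring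
      rw [h', this]
      simp only [mul_zero, zero_mul, sub_self, zero_add]
      positivity
    · rw [hdev _ _ _ h, hdev _ _ _ ha, ← hy, haN]
      have : ((a + 1 : ℕ) : ℝ) / N = y + 1 / N := by push_cast; rw [hy]; ring
      rw [this]
      have h2 : lam * ((N : ℝ) - N * y) * ((y + 1 / N - x 0) ^ 2 + bump ((b : ℝ) / N - x 1)
          + bump ((c : ℝ) / N - x 2) - ((y - x 0) ^ 2 + bump ((b : ℝ) / N - x 1)
          + bump ((c : ℝ) / N - x 2)))
          = 2 * (y - x 0) * (lam * (1 - y)) + lam * (1 - y) * (1 / N) := by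
        field_simp; ring
      rw [h2]
      have : lam * (1 - y) * (1 / N) ≤ lam * (1 / N) :=
        mul_le_mul_of_nonneg_right (mul_le_of_le_one_right ‹_› (by linarith)) hinv.le
      linarith
  have t2 : mu * (a : ℝ) * (extendZero (deviation (N := N) x) (a - 1, b + 1, c)
      - extendZero (deviation (N := N) x) (a, b, c))
      ≤ mu * y * (-(2 * (y - x 0)) + bumpDeriv ((b : ℝ) / N - x 1)) + 4 * mu * (1 / N) := by
    -- At M₁ = 0 the subtraction truncates, but the rate is zero.
    rcases Nat.eq_zero_or_pos a with h | h
    · have : y = 0 := by rw [hy, h]; simp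
      rw [this, h]
      simp only [Nat.cast_zero, mul_zero, zero_mul, zero_add]
      positivity
    · rw [hdev _ _ _ ((Nat.sub_le a 1).trans ha), hdev _ _ _ ha, ← hy, haN]
      have h1 : ((a - 1 : ℕ) : ℝ) / N = y - 1 / N := by
        rw [Nat.cast_sub h, hy]; push_cast; ring
      have h2 : ((b + 1 : ℕ) : ℝ) / N - x 1 = (b / N - x 1) + 1 / N := by push_cast; ring
      rw [h1, h2]
      have h3 := (abs_le.1 (abs_bump_add_sub_le ((b : ℝ) / N - x 1) (1 / N))).2
      have h4 := mul_le_mul_of_nonneg_left h3 (by positivity : 0 ≤ mu * (N * y))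
      have h5 : mu * (N * y) * (3 * (1 / N) ^ 2) = 3 * (mu * y) * (1 / N) := by field_simp
      have h6 : mu * (N * y) * (bumpDeriv ((b : ℝ) / N - x 1) * (1 / N))
        = mu * y * bumpDeriv ((b : ℝ) / N - x 1) := by field_simp
      have h7 : mu * (N * y) * ((y - 1 / N - x 0) ^ 2 - (y - x 0) ^ 2)
        = mu * y * (-(2 * (y - x 0))) + mu * y * (1 / N) := by field_simp; ring
      have h8 : mu * y * (1 / N) ≤ mu * (1 / N) :=
        mul_le_mul_of_nonneg_right (mul_le_of_le_one_right ‹_› (by linarith)) hinv.le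
      linear_combination h4 + h5 + h6 + h7 + 4 * h8
  have t3 : nu * (a : ℝ) * (extendZero (deviation (N := N) x) (a - 1, b, c + 2)
      - extendZero (deviation (N := N) x) (a, b, c))
      ≤ nu * y * (-(2 * (y - x 0)) + 2 * bumpDeriv ((c : ℝ) / N - x 2)) + 13 * nu * (1 / N) := by
    rcases Nat.eq_zero_or_pos a with h | h
    · have : y = 0 := by rw [hy, h]; simp
      rw [this, h]
      simp only [Nat.cast_zero, mul_zero, zero_mul, zero_add]
      positivity
    · rw [hdev _ _ _ ((Nat.sub_le a 1).trans ha), hdev _ _ _ ha, ← hy, haN]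
      have h1 : ((a - 1 : ℕ) : ℝ) / N = y - 1 / N := by
        rw [Nat.cast_sub h, hy]; push_cast; ring
      have h2 : ((c + 2 : ℕ) : ℝ) / N - x 2 = (c / N - x 2) + 2 / N := by push_cast; ring
      rw [h1, h2]
      have h3 := (abs_le.1 (abs_bump_add_sub_le ((c : ℝ) / N - x 2) (2 / N))).2
      have h4 := mul_le_mul_of_nonneg_left h3 (by positivity : 0 ≤ nu * (N * y))
      have h5 : nu * (N * y) * (3 * (2 / N) ^ 2) = 12 * (nu * y) * (1 / N) := by field_simp; ring
      have h6 : nu * (N * y) * (bumpDeriv ((c : ℝ) / N - x 2) * (2 / N))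
        = nu * y * (2 * bumpDeriv ((c : ℝ) / N - x 2)) := by field_simp
      have h7 : nu * (N * y) * ((y - 1 / N - x 0) ^ 2 - (y - x 0) ^ 2)
        = nu * y * (-(2 * (y - x 0))) + nu * y * (1 / N) := by field_simp; ring
      have h8 : nu * y * (1 / N) ≤ nu * (1 / N) :=
        mul_le_mul_of_nonneg_right (mul_le_of_le_one_right ‹_› (by linarith)) hinv.le
      linear_combination h4 + h5 + h6 + h7 + 13 * h8
  calc stateGenerator lam mu nu (deviation x) ⟨(a, b, c), ha⟩
      = lam * ((N : ℝ) - a) * (extendZero (deviation (N := N) x) (a + 1, b, c)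
          - extendZero (deviation (N := N) x) (a, b, c))
        + mu * (a : ℝ) * (extendZero (deviation (N := N) x) (a - 1, b + 1, c)
          - extendZero (deviation (N := N) x) (a, b, c))
        + nu * (a : ℝ) * (extendZero (deviation (N := N) x) (a - 1, b, c + 2)
          - extendZero (deviation (N := N) x) (a, b, c)) := rfl
    _ ≤ _ := add_le_add (add_le_add t1 t2) t3
    _ = _ := by ring

/-- One explicit Euler step for the deviation along the fluid limit. -/
theorem deviation_add_generator_le {lam mu nu : ℝ} (hlam : 0 ≤ lam) (hmu : 0 ≤ mu) (hnu : 0 ≤ nu)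
    {N : ℕ} (hN : 1 ≤ N) {x x' : EuclideanSpace ℝ (Fin 3)} {X D R T h : ℝ}
    (h0 : 0 ≤ h) (hT : h ≤ T) (hX : |x' 0| ≤ X) (hinc : ∀ i, |x' i - x i| ≤ D * h)
    (h₁ : |x' 0 - x 0 - h * (lam * (1 - x' 0) - (mu + nu) * x' 0)| ≤ R * h ^ 2)
    (h₂ : |x' 1 - x 1 - h * (mu * x' 0)| ≤ R * h ^ 2)
    (h₃ : |x' 2 - x 2 - h * (2 * nu * x' 0)| ≤ R * h ^ 2) (M : State N) :
    deviation x' M + h * stateGenerator lam mu nu (deviation x') M ≤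
      (1 + (2 * mu + 4 * nu) * h) * deviation x M + h * ((lam + 4 * mu + 13 * nu) / N)
      + (2 * (1 + X) * R + 4 * R + 6 * D ^ 2
        + (2 * mu + 4 * nu) * (2 * (1 + X) * D + 4 * D + 6 * D ^ 2 * T)) * h ^ 2 := by
  have hgen := mul_le_mul_of_nonneg_left (stateGenerator_deviation_le hlam hmu hnu hN x' M) h0
  obtain ⟨hy0, hy1⟩ := scaled_zero_mem M
  unfold deviation at hgen ⊢
  set y₀ := scaled M 0
  set z₁ := scaled M 1 - x' 1
  set z₂ := scaled M 2 - x' 2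
  have i0 := hinc 0
  have i1 := hinc 1
  have i2 := hinc 2
  -- The expansion is about the deviation z from the new point `x'`; adding the increment of the
  -- fluid solution gives the deviation from the old point `x`.
  have b1 := (abs_le.1 (abs_bump_add_sub_le z₁ (x' 1 - x 1))).1
  have b2 := (abs_le.1 (abs_bump_add_sub_le z₂ (x' 2 - x 2))).1
  have e1 : scaled M 1 - x 1 = z₁ + (x' 1 - x 1) := by simp [z₁]
  have e2 : scaled M 2 - x 2 = z₂ + (x' 2 - x 2) := by simp [z₂]
  have e0 : y₀ - x 0 = (y₀ - x' 0) + (x' 0 - x 0) := by ring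
  rw [e0, e1, e2]
  have hy : y₀ = (y₀ - x' 0) + x' 0 := by ring
  have hz0 : |y₀ - x' 0| ≤ 1 + X := by
    have := abs_le.1 hX
    rw [abs_le]; constructor <;> linarith
  have hX0 : 0 ≤ 1 + X := (abs_nonneg _).trans hz0
  have hsq : ∀ {d : ℝ}, |d| ≤ D * h → d ^ 2 ≤ D ^ 2 * h ^ 2 := fun {d} hd => by
    rw [← mul_pow, ← sq_abs]; exact pow_le_pow_left₀ (abs_nonneg d) hd 2
  have s1 := hsq i1
  have s2 := hsq i2
  have hprod : ∀ {p q P Q : ℝ}, |p| ≤ P → |q| ≤ Q → -(P * Q) ≤ p * q := fun {p q P Q} hp hq => by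
    have : |p * q| ≤ P * Q := by
      rw [abs_mul]; exact mul_le_mul hp hq (abs_nonneg _) ((abs_nonneg _).trans hp)
    exact (abs_le.1 this).1
  have p0 := hprod hz0 h₁
  have p1 := hprod (abs_bumpDeriv_le z₁) h₂
  have p2 := hprod (abs_bumpDeriv_le z₂) h₃
  have q0 := hprod hz0 i0
  have q1 := hprod (abs_bumpDeriv_le z₁) i1
  have q2 := hprod (abs_bumpDeriv_le z₂) i2
  have d1 := bumpDeriv_sq_le z₁
  have d2 := bumpDeriv_sq_le z₂
  generalize hδ0 : x' 0 - x 0 = δ₀ at *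
  generalize hδ1 : x' 1 - x 1 = δ₁ at *
  generalize hδ2 : x' 2 - x 2 = δ₂ at *
  generalize bumpDeriv z₁ = g₁ at *
  generalize bumpDeriv z₂ = g₂ at *
  have n1 := bump_nonneg z₁
  have n2 := bump_nonneg z₂
  generalize bump (z₁ + δ₁) = B₁' at *
  generalize bump (z₂ + δ₂) = B₂' at *
  generalize bump z₁ = B₁ at *
  generalize bump z₂ = B₂ at *
  generalize x' 0 = w at *
  generalize hzz : y₀ - w = z at *
  generalize y₀ = y at *
  subst hy
  generalize hc : (lam + 4 * mu + 13 * nu) / (N : ℝ) = c at *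
  set C := 2 * mu + 4 * nu with hC
  have hC0 : 0 ≤ C := by positivity
  -- the drift is one-sided Lipschitz for the deviation
  have hdrift : 2 * z * (lam * (1 - (z + w)) - (mu + nu) * (z + w)) + mu * (z + w) * g₁
      + 2 * nu * (z + w) * g₂
      ≤ 2 * z * (lam * (1 - w) - (mu + nu) * w) + mu * w * g₁ + 2 * nu * w * g₂
        + C * (z ^ 2 + B₁ + B₂) := by
    -- Young's inequality with g² ≤ 4B. The dissipative term −2(λ+μ+ν)z² is discarded (`k3`).
    have k1 : mu * (z * g₁) ≤ mu * ((4 * B₁ + z ^ 2) / 2) :=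
      mul_le_mul_of_nonneg_left (by linear_combination d1 / 2 + sq_nonneg (z - g₁) / 2) hmu
    have k2 : nu * (2 * (z * g₂)) ≤ nu * (4 * B₂ + z ^ 2) :=
      mul_le_mul_of_nonneg_left (by linear_combination d2 + sq_nonneg (z - g₂)) hnu
    have k3 : 0 ≤ (lam + mu + nu) * z ^ 2 := by positivity
    have k4 : 0 ≤ mu * z ^ 2 := by positivity
    have k5 : 0 ≤ nu * z ^ 2 := by positivity
    have k6 : 0 ≤ mu * B₂ := by positivity
    have k7 : 0 ≤ nu * B₁ := by positivity
    linear_combination k1 + k2 + 2 * k3 + 3 / 2 * k4 + 3 * k5 + 2 * k6 + 4 * k7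
  have hdrift' := mul_le_mul_of_nonneg_left hdrift h0
  have hh2 : 0 ≤ h ^ 2 := sq_nonneg h
  -- comparison of the deviations from the two points
  have hcomp : z ^ 2 + B₁ + B₂ ≤ (z + δ₀) ^ 2 + B₁' + B₂'
      + (2 * (1 + X) * D + 4 * D + 6 * D ^ 2 * T) * h := by
    have : D ^ 2 * h ^ 2 ≤ D ^ 2 * T * h := by
      have := mul_le_mul_of_nonneg_left (mul_le_mul_of_nonneg_right hT h0) (sq_nonneg D)
      linear_combination this
    linear_combination b1 + b2 + q1 + q2 + 2 * q0 + 3 * s1 + 3 * s2 + 6 * this + sq_nonneg δ₀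
  -- The drift bound involves the deviation from `x'`; after multiplication by Ch, passing to `x`
  -- costs only O(h²).
  have hcomp' := mul_le_mul_of_nonneg_left hcomp (mul_nonneg hC0 h0)
  linear_combination hgen + hdrift' + 2 * p0 + p1 + p2 + b1 + b2 + 3 * s1 + 3 * s2 + hcomp'
    + sq_nonneg δ₀

/-! ### Grönwall estimate for the mean deviation of the process. -/

theorem integrable_comp_of_abs_le {Ω S : Type*} [MeasurableSpace Ω] [MeasurableSpace S]
    [DiscreteMeasurableSpace S] {P : Measure Ω} [IsFiniteMeasure P] {Y : Ω → S}
    (hY : Measurable Y) {G : S → ℝ} {B : ℝ} (hG : ∀ y, |G y| ≤ B) :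
    Integrable (fun ω => G (Y ω)) P :=
  Integrable.of_bound ((Measurable.of_discrete (f := G)).comp hY).aestronglyMeasurable B
    (Eventually.of_forall fun ω => by simpa using hG (Y ω))

/-- Only this averaged form of the Markov property is used; the history disappears by the tower
property. -/
theorem IsMarkovProcess.integral_eq {Ω S : Type*} [MeasurableSpace Ω] [MeasurableSpace S]
    {P : Measure Ω} [IsProbabilityMeasure P] {p : ℝ≥0 → Kernel S S} {X : ℝ≥0 → Ω → S}
    (hX : IsMarkovProcess P p X) (s t : ℝ≥0) {F : S → ℝ} (hF : Measurable F)
    {B : ℝ} (hB : ∀ y, |F y| ≤ B) :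
    ∫ ω, F (X (s + t) ω) ∂P = ∫ ω, ∫ y, F y ∂(p t (X s ω)) ∂P := by
  have hm : (⨆ r ∈ Set.Iic s, MeasurableSpace.comap (X r) inferInstance)
      ≤ (inferInstance : MeasurableSpace Ω) :=
    iSup₂_le fun r _ => (hX.measurable r).comap_le
  rw [← integral_congr_ae (hX.condExp_eq s t F hF ⟨B, hB⟩), integral_condExp hm]

/-- The mean deviation from the fluid limit at time `T` is controlled by the initial one. -/
theorem IsPhotonProcess.exists_integral_deviation_le {lam mu nu : ℝ} (hlam : 0 ≤ lam)
    (hmu : 0 ≤ mu) (hnu : 0 ≤ nu) {u : EuclideanSpace ℝ (Fin 3)}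
    {x : ℝ → EuclideanSpace ℝ (Fin 3)} (hx : IsFluidSolution lam mu nu u x) (T : ℝ≥0) {N : ℕ}
    (hN : 1 ≤ N) {Ω : Type*} [MeasurableSpace Ω] {P : Measure Ω} [IsProbabilityMeasure P]
    {Xi : ℝ≥0 → Ω → State N} (hXi : IsPhotonProcess lam mu nu N P Xi) :
    ∫ ω, deviation (x T) (Xi T ω) ∂P ≤ Real.exp ((2 * mu + 4 * nu) * T) *
      ((∫ ω, deviation u (Xi 0 ω) ∂P) + T * ((lam + 4 * mu + 13 * nu) / N)) := by
  obtain ⟨p, hp, hgen, hM⟩ := hXi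
  have := hp.markov
  obtain ⟨X, D, R, hX0, hD0, hR0, hb⟩ := hx.exists_bounds hlam hmu hnu T
  set B := (1 + X) ^ 2 + 2 with hB
  have hB0 : 0 ≤ B := by positivity
  set K₁ := 2 * (1 + X) * R + 4 * R + 6 * D ^ 2
    + (2 * mu + 4 * nu) * (2 * (1 + X) * D + 4 * D + 6 * D ^ 2 * T)
  -- The semigroup expansion error, of order N²; harmless because the Grönwall bound does not
  -- contain K.
  set K₂ := (lam + mu + nu) * N * (2 * ((lam + mu + nu) * N * (2 * B)))
  have hdevX : ∀ s : ℝ≥0, s ≤ T → ∀ M : State N, |deviation (x s) M| ≤ B := fun s hs =>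
    abs_deviation_le (by
      have := (hb s 0 s.2 le_rfl (by simpa using hs)).1
      simpa using this)
  have hint : ∀ s : ℝ≥0, s ≤ T → Integrable (fun ω => deviation (x s) (Xi s ω)) P := fun s hs =>
    integrable_comp_of_abs_le (hM.measurable s) (hdevX s hs)
  have key := le_exp_mul_of_step (f := fun s : ℝ≥0 => ∫ ω, deviation (x s) (Xi s ω) ∂P) (T := T)
    (C := 2 * mu + 4 * nu) (a := (lam + 4 * mu + 13 * nu) / N) (K := K₁ + K₂) (by positivity)
    (by positivity) (by positivity) (integral_nonneg fun ω => deviation_nonneg _ _) ?_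
  · simpa [hx.init] using key
  intro s h hsh
  have hs : s ≤ T := le_self_add.trans hsh
  have hh : h ≤ T := le_add_self.trans hsh
  have hbd := hdevX (s + h) hsh
  -- The target is x(s+h) throughout the semigroup expansion, since the Markov property needs a
  -- fixed test function; hence the fluid expansions at the right end.
  have hstep : ∀ M : State N, ∫ M', deviation (x (s + h : ℝ≥0)) M' ∂(p h M)
      ≤ (1 + (2 * mu + 4 * nu) * h) * deviation (x s) M
        + (h * ((lam + 4 * mu + 13 * nu) / N) + (K₁ + K₂) * h ^ 2) := by
    intro M
    have h1 := (abs_le.1 (abs_integral_sub_generator_le hlam hmu hnu hp hgen hbd h M)).2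
    obtain ⟨c1, c2, c3, c4, c5⟩ := hb s h s.coe_nonneg h.coe_nonneg (by exact_mod_cast hsh)
    rw [NNReal.coe_add] at h1 ⊢
    have h2 := deviation_add_generator_le hlam hmu hnu hN h.coe_nonneg (NNReal.coe_le_coe.2 hh)
      c1 c2 c3 c4 c5 M
    linear_combination h1 + h2
  have hleft : Integrable (fun ω => ∫ M', deviation (x (s + h : ℝ≥0)) M' ∂(p h (Xi s ω))) P :=
    integrable_comp_of_abs_le (G := fun M => ∫ M', deviation (x (s + h : ℝ≥0)) M' ∂(p h M))
      (hM.measurable s) fun M => abs_integral_le_of_abs_le hbd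
  calc ∫ ω, deviation (x (s + h : ℝ≥0)) (Xi (s + h) ω) ∂P
      = ∫ ω, ∫ M', deviation (x (s + h : ℝ≥0)) M' ∂(p h (Xi s ω)) ∂P :=
        hM.integral_eq s h Measurable.of_discrete hbd
    _ ≤ ∫ ω, ((1 + (2 * mu + 4 * nu) * h) * deviation (x s) (Xi s ω)
        + (h * ((lam + 4 * mu + 13 * nu) / N) + (K₁ + K₂) * h ^ 2)) ∂P :=
        integral_mono hleft (((hint s hs).const_mul _).add (integrable_const _))
          fun ω => hstep (Xi s ω)
    _ = _ := by
        rw [integral_add ((hint s hs).const_mul _) (integrable_const _), integral_const_mul]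
        simp; ring

/-! ### Convergence in probability versus convergence of the mean deviation. -/

theorem dist_scaled_sq {N : ℕ} (M : State N) (x : EuclideanSpace ℝ (Fin 3)) :
    dist (scaled M) x ^ 2
      = (scaled M 0 - x 0) ^ 2 + (scaled M 1 - x 1) ^ 2 + (scaled M 2 - x 2) ^ 2 := by
  rw [EuclideanSpace.dist_eq, Real.sq_sqrt (by positivity), Fin.sum_univ_three]
  simp only [Real.dist_eq, sq_abs]

theorem deviation_le_dist_sq {N : ℕ} (M : State N) (x : EuclideanSpace ℝ (Fin 3)) :
    deviation x M ≤ dist (scaled M) x ^ 2 := by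
  rw [dist_scaled_sq]
  unfold deviation
  linarith [bump_le_sq (scaled M 1 - x 1), bump_le_sq (scaled M 2 - x 2)]

theorem measurable_dist_scaled {N : ℕ} (x : EuclideanSpace ℝ (Fin 3)) :
    Measurable fun M : State N => dist (scaled M) x := Measurable.of_discrete

/-- Convergence in probability implies convergence to zero of the mean deviation. -/
theorem tendsto_integral_deviation {Ω : ℕ → Type*} [∀ N, MeasurableSpace (Ω N)]
    {P : ∀ N, Measure (Ω N)} [∀ N, IsProbabilityMeasure (P N)] {Y : ∀ N, Ω N → State N}
    (hY : ∀ N, 1 ≤ N → Measurable (Y N)) {u : EuclideanSpace ℝ (Fin 3)}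
    (h : TendstoInProbability P (fun N ω => scaled (Y N ω)) u) :
    Tendsto (fun N => ∫ ω, deviation u (Y N ω) ∂(P N)) atTop (𝓝 0) := by
  set B := (1 + |u 0|) ^ 2 + 2
  have hB : ∀ {N : ℕ} (M : State N), deviation u M ≤ B := fun M => deviation_le le_rfl M
  have hB0 : 0 ≤ B := by positivity
  -- Split by distance: below ε the deviation is at most ε², elsewhere at most B. Boundedness of
  -- `deviation` is what makes convergence in probability sufficient.
  have hle : ∀ ε : ℝ, 0 < ε → ∀ N, 1 ≤ N → ∫ ω, deviation u (Y N ω) ∂(P N)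
      ≤ ε ^ 2 + B * (P N).real {ω | ε ≤ dist (scaled (Y N ω)) u} := by
    intro ε hε N hN
    set A := {ω | ε ≤ dist (scaled (Y N ω)) u}
    have hA : MeasurableSet A :=
      measurableSet_le measurable_const ((measurable_dist_scaled u).comp (hY N hN))
    have hI : Integrable (A.indicator fun _ => B) (P N) := (integrable_const B).indicator hA
    calc ∫ ω, deviation u (Y N ω) ∂(P N) ≤ ∫ ω, (ε ^ 2 + A.indicator (fun _ => B) ω) ∂(P N) := by
          refine integral_mono_of_nonneg (Eventually.of_forall fun ω => deviation_nonneg _ _)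
            ((integrable_const _).add hI) (Eventually.of_forall fun ω => ?_)
          by_cases hω : ω ∈ A
          · simp only [Set.indicator_of_mem hω]
            linarith [hB (Y N ω), sq_nonneg ε]
          · simp only [Set.indicator_of_notMem hω, add_zero]
            exact (deviation_le_dist_sq _ _).trans
              (pow_le_pow_left₀ dist_nonneg (not_le.1 hω).le 2)
      _ = _ := by
          rw [integral_add (integrable_const _) hI, integral_indicator_const _ hA]
          simp [mul_comm]
  rw [Metric.tendsto_atTop']
  intro δ hδ
  have hε : 0 < √(δ / 2) := Real.sqrt_pos.2 (by positivity)
  have hlim : Tendsto (fun N => (P N).real {ω | √(δ / 2) ≤ dist (scaled (Y N ω)) u}) atTop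
      (𝓝 0) :=
    (ENNReal.tendsto_toReal ENNReal.zero_ne_top).comp (h _ hε)
  have hlim' := hlim.const_mul B
  rw [mul_zero] at hlim'
  obtain ⟨n, hn⟩ := eventually_atTop.1 (hlim'.eventually_lt_const (half_pos hδ))
  refine ⟨n + 1, fun N hN => ?_⟩
  have h1 := hle _ hε N (by omega)
  rw [Real.sq_sqrt (by positivity)] at h1
  rw [Real.dist_eq, sub_zero, abs_of_nonneg (integral_nonneg fun ω => deviation_nonneg _ _)]
  linarith [hn N (by omega)]

/-- Convergence to zero of the mean deviation implies convergence in probability. -/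
theorem tendstoInProbability_of_integral_deviation {Ω : ℕ → Type*} [∀ N, MeasurableSpace (Ω N)]
    {P : ∀ N, Measure (Ω N)} [∀ N, IsProbabilityMeasure (P N)] {Y : ∀ N, Ω N → State N}
    (hY : ∀ N, 1 ≤ N → Measurable (Y N)) {x : EuclideanSpace ℝ (Fin 3)}
    (h : Tendsto (fun N => ∫ ω, deviation x (Y N ω) ∂(P N)) atTop (𝓝 0)) :
    TendstoInProbability P (fun N ω => scaled (Y N ω)) x := by
  intro ε hε
  have hc : 0 < ε ^ 2 / (1 + ε ^ 2) := by positivity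
  set c := ε ^ 2 / (1 + ε ^ 2)
  have hlim := ENNReal.tendsto_ofReal (h.div_const c)
  rw [zero_div, ENNReal.ofReal_zero] at hlim
  refine tendsto_of_tendsto_of_tendsto_of_le_of_le' tendsto_const_nhds hlim
    (Eventually.of_forall fun _ => zero_le) ?_
  filter_upwards [eventually_ge_atTop 1] with N hN
  have hint : Integrable (fun ω => deviation x (Y N ω)) (P N) :=
    integrable_comp_of_abs_le (hY N hN) (abs_deviation_le le_rfl)
  -- Markov's inequality at the level c that `sq_div_le_lyapunov` attaches to distance ε.
  have hmark := mul_meas_ge_le_integral_of_nonneg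
    (Eventually.of_forall fun ω => deviation_nonneg x (Y N ω)) hint c
  have hsub : {ω | ε ≤ dist (scaled (Y N ω)) x} ⊆ {ω | c ≤ deviation x (Y N ω)} := by
    intro ω hω
    refine sq_div_le_lyapunov ?_
    rw [← dist_scaled_sq]
    exact pow_le_pow_left₀ hε.le hω 2
  refine (measure_mono hsub).trans ?_
  rw [← ofReal_measureReal]
  refine ENNReal.ofReal_le_ofReal ((le_div_iff₀' hc).2 hmark)

end TwoLevelAtoms

theorem theorem1 (lam mu nu : ℝ) (hlam : 0 ≤ lam) (hmu : 0 ≤ mu) (hnu : 0 ≤ nu)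
    {Ω : ℕ → Type*} [∀ N, MeasurableSpace (Ω N)]
    (P : ∀ N, Measure (Ω N)) [∀ N, IsProbabilityMeasure (P N)]
    (Xi : ∀ N, ℝ≥0 → Ω N → TwoLevelAtoms.State N)
    (hXi : ∀ N, 1 ≤ N → TwoLevelAtoms.IsPhotonProcess lam mu nu N (P N) (Xi N))
    (u : EuclideanSpace ℝ (Fin 3))
    (h0 : TwoLevelAtoms.TendstoInProbability P (fun N ω => TwoLevelAtoms.scaled (Xi N 0 ω)) u) :
    ∃ x : ℝ → EuclideanSpace ℝ (Fin 3),
      TwoLevelAtoms.IsFluidSolution lam mu nu u x ∧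
      (∀ y, TwoLevelAtoms.IsFluidSolution lam mu nu u y → Set.EqOn y x (Set.Ici 0)) ∧
      ∀ t : ℝ≥0, 0 < t →
        TwoLevelAtoms.TendstoInProbability P
          (fun N ω => TwoLevelAtoms.scaled (Xi N t ω)) (x (t : ℝ)) := by
  have hx := TwoLevelAtoms.isFluidSolution_fluid lam mu nu u
  have hmeas : ∀ N, 1 ≤ N → ∀ t, Measurable (Xi N t) := fun N hN t => by
    obtain ⟨p, -, -, hM⟩ := hXi N hN
    exact hM.measurable t
  refine ⟨TwoLevelAtoms.fluid lam mu nu u, hx, fun y hy => hy.eqOn hx, fun t _ => ?_⟩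
  refine TwoLevelAtoms.tendstoInProbability_of_integral_deviation (fun N hN => hmeas N hN t) ?_
  have h1 := TwoLevelAtoms.tendsto_integral_deviation (fun N hN => hmeas N hN 0) h0
  have h2 := ((h1.add ((tendsto_const_div_atTop_nhds_zero_nat (lam + 4 * mu + 13 * nu)).const_mul
    (t : ℝ))).const_mul (Real.exp ((2 * mu + 4 * nu) * t)))
  simp only [mul_zero, add_zero] at h2
  refine tendsto_of_tendsto_of_tendsto_of_le_of_le' tendsto_const_nhds h2
    (Eventually.of_forall fun N => integral_nonneg fun ω => TwoLevelAtoms.deviation_nonneg _ _) ?_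
  filter_upwards [eventually_ge_atTop 1] with N hN
  exact (hXi N hN).exists_integral_deviation_le hlam hmu hnu hx t hN
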